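/- All monoids are commutative and written additively. A homomorphism of monoids $\theta:P\to Q$ is local if $\theta^{-1}(Q^{*})=P^{*}$, where ${}^{*}$ denotes the group of units. A monoid $Q$ is valuative if it is integral (cancellative) and for every $x$ in its group completion $Q^{gp}$ one has $x\in Q$ or $-x\in Q$. If $Q_1,Q_2$ are submonoids of an abelian group $L$, then $Q_2$ dominates $Q_1$ if $Q_1\subseteq Q_2$ and the inclusion $Q_1\to Q_2$ is local; this defines a partial order on the set of submonoids of $L$. We write $Q^{gp}=L$ when the canonical homomorphism $Q^{gp}\to L$ induced by the inclusion $Q\subseteq L$ is an isomorphism. **Proposition.** Let $L$ be an abelian group. 1. A submonoid $Q$ of $L$ is a maximal element for the domination order if and only if $Q$ is valuative and $Q^{gp}=L$. 2. Every submonoid of $L$ is dominated by a valuative submonoid $Q$ of $L$ with $Q^{gp}=L$. 3. If $L$ is finitely generated, then every finitely generated submonoid of $L$ is dominated by a finitely generated valuative submonoid $Q$ of $L$ with $Q^{gp}=L$. -/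

import Mathlib

open Algebra

/-- A homomorphism `θ : P → Q` of commutative monoids is local if `θ⁻¹(Q*) = P*`, where `*` denotes
the set of units. -/
def IsLocalAddHom {P Q : Type*} [AddCommMonoid P] [AddCommMonoid Q] (θ : P →+ Q) : Prop :=
  θ ⁻¹' {q : Q | IsAddUnit q} = {p : P | IsAddUnit p}

/-- A commutative monoid `M` is valuative if it is integral (cancellative) and, for every `x` in its
group completion, `x` or `-x` belongs to (the image of) `M`. -/
def IsValuativeAddMonoid (M : Type*) [AddCommMonoid M] : Prop :=
  IsCancelAdd M ∧ ∀ x : GrothendieckAddGroup M,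
    x ∈ AddMonoidHom.mrange (GrothendieckAddGroup.of (M := M)) ∨
      -x ∈ AddMonoidHom.mrange (GrothendieckAddGroup.of (M := M))

namespace AddSubmonoid

variable {L : Type*} [AddCommGroup L]

/-- `P.DominatedBy Q`: the submonoid `Q` of `L` dominates `P`, that is, `P ⊆ Q` and the inclusion
homomorphism `P → Q` is local. -/
def DominatedBy (P Q : AddSubmonoid L) : Prop :=
  ∃ h : P ≤ Q, IsLocalAddHom (AddSubmonoid.inclusion h)

/-- `Q` is a maximal element for the domination order: the only submonoid of `L` dominating `Q`
is `Q` itself. -/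
def IsDominationMaximal (Q : AddSubmonoid L) : Prop :=
  ∀ P : AddSubmonoid L, Q.DominatedBy P → P = Q

/-- The canonical homomorphism `Q^gp → L` induced by the inclusion of a submonoid `Q` of `L`. -/
noncomputable def gpMap (Q : AddSubmonoid L) : GrothendieckAddGroup Q →+ L :=
  GrothendieckAddGroup.lift Q.subtype

/-- `Q^gp = L`: the canonical homomorphism `Q^gp → L` is an isomorphism. -/
def GpEqTop (Q : AddSubmonoid L) : Prop :=
  Function.Bijective Q.gpMap

end AddSubmonoid

namespace AddSubmonoid

variable {L : Type*} [AddCommGroup L]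

/-! Maximality and being valuative with group `L` both mean that `Q` contains `x` or `-x` for every
`x` in `L`. If `Q` is maximal and contains neither, adjoining either one creates a new inverse in
`Q`; this puts `-(n • x)` and some `m • x`, with `n, m > 0`, in `Q` but `n • x` outside it, which is
contradictory. Zorn's lemma then gives domination by a maximal submonoid. In the finitely generated
case, Farkas' lemma yields `f : L →+ ℤ`, nonnegative on `P` and zero on `P` only at units; the
half-space `f ≥ 0` is the required submonoid. -/

theorem dominatedBy_iff {P Q : AddSubmonoid L} :
    P.DominatedBy Q ↔ P ≤ Q ∧ ∀ x ∈ P, -x ∈ Q → -x ∈ P := by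
  have unit_iff : ∀ (R : AddSubmonoid L) (x : R), IsAddUnit x ↔ -(x : L) ∈ R := by
    intro R x
    rw [isAddUnit_iff_exists_neg]
    constructor
    · rintro ⟨y, hy⟩
      have hxy : (x : L) + y = 0 := by simpa using congrArg Subtype.val hy
      rw [neg_eq_of_add_eq_zero_right hxy]
      exact y.2
    · intro h
      exact ⟨⟨-(x : L), h⟩, Subtype.ext (by simp)⟩
  constructor
  · rintro ⟨h, hloc⟩
    refine ⟨h, fun x hx hxQ => ?_⟩
    have hmem : (⟨x, hx⟩ : P) ∈ {p : P | IsAddUnit p} := by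
      rw [← hloc]
      exact (unit_iff Q _).2 hxQ
    exact (unit_iff P _).1 hmem
  · rintro ⟨h, hloc⟩
    refine ⟨h, Set.ext fun x => ?_⟩
    simp only [Set.mem_preimage, Set.mem_ofPred_eq, unit_iff]
    exact ⟨hloc x x.2, fun hx => h hx⟩

theorem DominatedBy.refl (P : AddSubmonoid L) : P.DominatedBy P :=
  dominatedBy_iff.2 ⟨le_rfl, fun _ _ h => h⟩

theorem DominatedBy.trans {P Q R : AddSubmonoid L} (h₁ : P.DominatedBy Q)
    (h₂ : Q.DominatedBy R) : P.DominatedBy R := by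
  rw [dominatedBy_iff] at *
  exact ⟨h₁.1.trans h₂.1, fun x hx hxR => h₁.2 x hx (h₂.2 x (h₁.1 hx) hxR)⟩

theorem gpMap_of (Q : AddSubmonoid L) (q : Q) :
    Q.gpMap (GrothendieckAddGroup.of q) = q :=
  DFunLike.congr_fun (GrothendieckAddGroup.lift.symm_apply_apply Q.subtype) q

theorem gpMap_injective (Q : AddSubmonoid L) : Function.Injective Q.gpMap := by
  rw [injective_iff_map_eq_zero]
  intro x hx
  obtain ⟨⟨a, b⟩, hab⟩ := (AddLocalization.addMonoidOf (⊤ : AddSubmonoid Q)).surj x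
  have hab' : x + GrothendieckAddGroup.of (b : Q) = GrothendieckAddGroup.of a := hab
  have h := congrArg Q.gpMap hab'
  rw [map_add, hx, zero_add, gpMap_of, gpMap_of] at h
  rw [Subtype.ext h] at hab'
  simpa using hab'

/-- A submonoid of `L` is valuative with group completion `L` exactly when it contains each
element of `L` or its opposite. -/
theorem isValuative_and_gpEqTop_iff (Q : AddSubmonoid L) :
    (IsValuativeAddMonoid Q ∧ Q.GpEqTop) ↔ ∀ x : L, x ∈ Q ∨ -x ∈ Q := by
  have mem_of_range : ∀ y : GrothendieckAddGroup Q,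
      y ∈ AddMonoidHom.mrange (GrothendieckAddGroup.of (M := Q)) → Q.gpMap y ∈ Q := by
    rintro _ ⟨q, rfl⟩
    rw [gpMap_of]
    exact q.2
  have range_of_mem : ∀ y : GrothendieckAddGroup Q, Q.gpMap y ∈ Q →
      y ∈ AddMonoidHom.mrange (GrothendieckAddGroup.of (M := Q)) := fun y hy =>
    ⟨⟨Q.gpMap y, hy⟩, Q.gpMap_injective (by rw [gpMap_of])⟩
  constructor
  · rintro ⟨⟨-, hval⟩, hbij⟩ x
    obtain ⟨y, rfl⟩ := hbij.2 x
    rw [← map_neg]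
    exact (hval y).imp (mem_of_range _) (mem_of_range _)
  · intro h
    refine ⟨⟨inferInstance, fun y => ?_⟩, Q.gpMap_injective, fun x => ?_⟩
    · refine (h (Q.gpMap y)).imp (range_of_mem _) fun hy => range_of_mem _ ?_
      rwa [map_neg]
    · obtain hx | hx := h x
      · exact ⟨GrothendieckAddGroup.of ⟨x, hx⟩, gpMap_of _ _⟩
      · exact ⟨-GrothendieckAddGroup.of ⟨-x, hx⟩, by rw [map_neg, gpMap_of, neg_neg]⟩

/-- If adjoining `x` to `Q` does not give a submonoid dominating `Q`, then the opposite of some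
positive multiple of `x` is a non-unit of `Q`. -/
theorem exists_nsmul_of_not_dominatedBy_sup {Q : AddSubmonoid L} {x : L}
    (h : ¬ Q.DominatedBy (Q ⊔ multiples x)) :
    ∃ n : ℕ, n ≠ 0 ∧ -(n • x) ∈ Q ∧ n • x ∉ Q := by
  rw [dominatedBy_iff] at h
  push Not at h
  obtain ⟨q, hq, hqx, hqQ⟩ := h le_sup_left
  obtain ⟨r, hr, z, hz, hrz⟩ := mem_sup.1 hqx
  obtain ⟨n, rfl⟩ := mem_multiples_iff _ _ |>.1 hz
  have hn : -(n • x) = q + r := by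
    rw [neg_eq_iff_add_eq_zero, ← neg_add_cancel q, ← hrz]
    abel
  refine ⟨n, ?_, hn ▸ Q.add_mem hq hr, fun hnx => hqQ ?_⟩
  · rintro rfl
    apply hqQ
    rw [← hrz, zero_smul, add_zero]
    exact hr
  · rw [← hrz]
    exact Q.add_mem hr hnx

theorem isDominationMaximal_iff (Q : AddSubmonoid L) :
    Q.IsDominationMaximal ↔ ∀ x : L, x ∈ Q ∨ -x ∈ Q := by
  constructor
  · intro h x
    have mem_of_dom : ∀ y : L, Q.DominatedBy (Q ⊔ multiples y) → y ∈ Q := fun y hy => by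
      rw [← h _ hy]
      exact mem_sup_right (mem_multiples y)
    by_contra! hx
    obtain ⟨n, hn, hnQ, hnQ'⟩ := exists_nsmul_of_not_dominatedBy_sup (mt (mem_of_dom x) hx.1)
    obtain ⟨m, hm, hmQ, -⟩ := exists_nsmul_of_not_dominatedBy_sup (mt (mem_of_dom (-x)) hx.2)
    apply hnQ'
    obtain ⟨k, rfl⟩ := Nat.exists_eq_succ_of_ne_zero hm
    -- With `m = k + 1`, this is `n = n * m - k * n`.
    have h₁ : n • x = n • (-((k + 1) • -x)) + k • (-(n • x)) := by
      simp only [smul_neg, neg_neg, ← mul_smul, add_smul, smul_add, one_smul, mul_comm k n]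
      abel
    rw [h₁]
    exact Q.add_mem (Q.nsmul_mem hmQ n) (Q.nsmul_mem hnQ k)
  · intro h P hP
    rw [dominatedBy_iff] at hP
    refine le_antisymm (fun x hx => (h x).elim id fun hx' => ?_) hP.1
    simpa using hP.2 (-x) hx' (by simpa using hx)

theorem exists_dominatedBy_isDominationMaximal (P : AddSubmonoid L) :
    ∃ Q : AddSubmonoid L, P.DominatedBy Q ∧ Q.IsDominationMaximal := by
  have hchain : ∀ c : Set {Q : AddSubmonoid L // P.DominatedBy Q},
      IsChain (fun Q R => Q.1.DominatedBy R.1) c → c.Nonempty →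
        ∃ ub : {Q : AddSubmonoid L // P.DominatedBy Q}, ∀ Q ∈ c, Q.1.DominatedBy ub.1 := by
    intro c hc hne
    have : Nonempty c := hne.to_subtype
    have hdir : Directed (· ≤ ·) fun Q : c => Q.1.1 := fun Q R => by
      obtain rfl | hQR := eq_or_ne Q R
      · exact ⟨Q, le_rfl, le_rfl⟩
      · obtain h | h := hc Q.2 R.2 (Subtype.coe_injective.ne hQR)
        · exact ⟨R, h.1, le_rfl⟩
        · exact ⟨Q, le_rfl, h.1⟩
    -- An inverse in the union already lies in one member of the chain, which is comparable with
    -- `Q`.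
    have hdom : ∀ Q ∈ c, Q.1.DominatedBy (⨆ Q : c, Q.1.1) := by
      intro Q hQ
      refine dominatedBy_iff.2 ⟨le_iSup (fun Q : c => Q.1.1) ⟨Q, hQ⟩, fun x hx hx' => ?_⟩
      obtain ⟨R, hR⟩ := (mem_iSup_of_directed hdir).1 hx'
      obtain h | h := eq_or_ne Q R.1
      · rwa [h]
      · obtain h | h := hc hQ R.2 h
        · exact (dominatedBy_iff.1 h).2 x hx hR
        · exact h.1 hR
    obtain ⟨Q, hQ⟩ := hne
    exact ⟨⟨_, Q.2.trans (hdom Q hQ)⟩, hdom⟩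
  have : Nonempty {Q : AddSubmonoid L // P.DominatedBy Q} := ⟨⟨P, DominatedBy.refl P⟩⟩
  obtain ⟨Q, hQ⟩ := exists_maximal_of_nonempty_chains_bounded hchain
    fun h₁ h₂ => h₁.trans h₂
  exact ⟨Q.1, Q.2, fun R hR => le_antisymm (hQ ⟨R, Q.2.trans hR⟩ hR).1 hR.1⟩

end AddSubmonoid

section Farkas

variable {L : Type*} [AddCommGroup L]

/-- Modulo torsion `L` is free of finite rank, so functionals detect the nonzero image of `b`. -/
theorem exists_addMonoidHom_int_neg_of_not_isOfFinAddOrder [Module.Finite ℤ L] {b : L}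
    (hb : ∀ n : ℕ, n ≠ 0 → n • b ≠ 0) : ∃ f : L →+ ℤ, f b < 0 := by
  have hb' : (Submodule.torsion ℤ L).mkQ b ≠ 0 := by
    intro h
    rw [Submodule.mkQ_apply, Submodule.Quotient.mk_eq_zero, Submodule.mem_torsion_iff] at h
    obtain ⟨a, ha⟩ := h
    have ha0 : (a : ℤ) ≠ 0 := nonZeroDivisors.ne_zero a.2
    refine hb (a : ℤ).natAbs (Int.natAbs_ne_zero.2 ha0) ?_
    rw [Submonoid.smul_def] at ha
    obtain h | h := Int.natAbs_eq (a : ℤ)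
    · rw [h, natCast_zsmul] at ha
      exact ha
    · rw [h, neg_smul, natCast_zsmul, neg_eq_zero] at ha
      exact ha
  obtain ⟨g, hg⟩ : ∃ g : Module.Dual ℤ (L ⧸ Submodule.torsion ℤ L),
      g ((Submodule.torsion ℤ L).mkQ b) ≠ 0 := Module.Projective.exists_dual_ne_zero ℤ hb'
  let f : L →+ ℤ := (g.comp (Submodule.torsion ℤ L).mkQ).toAddMonoidHom
  have hf : f b ≠ 0 := hg
  obtain h | h := hf.lt_or_gt
  · exact ⟨f, h⟩
  · exact ⟨-f, by simpa using h⟩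

/-- Farkas' lemma over the integers: an element with no positive multiple in the submonoid
generated by a finite family is separated from that family by a homomorphism to `ℤ`. -/
theorem exists_addMonoidHom_int_separating [Module.Finite ℤ L] {ι : Type*} (s : Finset ι) :
    ∀ (v : ι → L) (b : L), (∀ n : ℕ, n ≠ 0 → n • b ∉ AddSubmonoid.closure (v '' s)) →
      ∃ f : L →+ ℤ, (∀ i ∈ s, 0 ≤ f (v i)) ∧ f b < 0 := by
  classical
  induction s using Finset.induction_on with
  | empty =>
    intro v b hb
    obtain ⟨f, hf⟩ := exists_addMonoidHom_int_neg_of_not_isOfFinAddOrder (b := b)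
      fun n hn h => hb n hn (h ▸ zero_mem _)
    exact ⟨f, by simp, hf⟩
  | insert j s hj ih =>
    intro v b hb
    have hsub : AddSubmonoid.closure (v '' s) ≤ AddSubmonoid.closure (v '' (insert j s : Finset ι)) :=
      AddSubmonoid.closure_mono (Set.image_mono (by simp))
    have hvj : v j ∈ AddSubmonoid.closure (v '' (insert j s : Finset ι)) :=
      AddSubmonoid.subset_closure ⟨j, by simp, rfl⟩
    obtain ⟨f, hf, hfb⟩ := ih v b fun n hn h => hb n hn (hsub h)
    obtain hfj | hfj := le_or_gt 0 (f (v j))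
    · refine ⟨f, fun i hi => ?_, hfb⟩
      obtain rfl | hi := Finset.mem_insert.1 hi
      exacts [hfj, hf i hi]
    obtain ⟨a, ha⟩ := Int.eq_ofNat_of_zero_le (neg_nonneg.2 hfj.le)
    -- Projection along `v j` onto the kernel of `f`, scaled by `a = -f (v j) > 0` to stay integral.
    let T : L →+ L := a • AddMonoidHom.id L + ((zmultiplesHom L) (v j)).comp f
    have hT : ∀ x, T x = a • x + f x • v j := fun x => by simp [T]
    have hTj : T (v j) = 0 := by
      rw [hT, ← natCast_zsmul, ← add_smul, show (a : ℤ) + f (v j) = 0 by omega, zero_smul]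
    obtain ⟨g, hg, hgb⟩ := ih (T ∘ v) (T b) fun n hn h => by
      have hle : AddSubmonoid.closure ((T ∘ v) '' s) ≤
          AddSubmonoid.closure (v '' (insert j s : Finset ι)) := by
        rw [AddSubmonoid.closure_le]
        rintro _ ⟨i, hi, rfl⟩
        obtain ⟨c, hc⟩ := Int.eq_ofNat_of_zero_le (hf i hi)
        rw [Function.comp_apply, hT, hc, natCast_zsmul]
        exact add_mem (nsmul_mem (hsub (AddSubmonoid.subset_closure ⟨i, hi, rfl⟩)) _)
          (nsmul_mem hvj _)
      obtain ⟨c, hc⟩ := Int.eq_ofNat_of_zero_le (neg_nonneg.2 hfb.le)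
      refine hb (n * a) (mul_ne_zero hn (by omega)) ?_
      have hnb : (n * a) • b = n • T b + n • c • v j := by
        rw [hT, ← natCast_zsmul (v j) c, show (c : ℤ) = -f b by omega, mul_smul, smul_add,
          add_assoc, ← smul_add, neg_smul, add_neg_cancel, smul_zero, add_zero]
      rw [hnb]
      exact add_mem (hle h) (nsmul_mem (nsmul_mem hvj _) _)
    refine ⟨g.comp T, fun i hi => ?_, hgb⟩
    obtain rfl | hi := Finset.mem_insert.1 hi
    · simp [hTj]
    · exact hg i hi

end Farkas

namespace AddSubmonoid

variable {L : Type*} [AddCommGroup L]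

/-- A finitely generated submonoid has a homomorphism to `ℤ` that is nonnegative on it and vanishes
only at its units. -/
theorem FG.exists_addMonoidHom_int [Module.Finite ℤ L] {P : AddSubmonoid L} (hP : P.FG) :
    ∃ f : L →+ ℤ, ∀ x ∈ P, 0 ≤ f x ∧ (f x ≤ 0 → -x ∈ P) := by
  classical
  obtain ⟨S, rfl⟩ := hP
  have hsep : ∀ x ∈ S, ∃ f : L →+ ℤ, (∀ y ∈ S, 0 ≤ f y) ∧ (-x ∉ closure (S : Set L) → 0 < f x) := by
    intro x hx
    by_cases hxS : -x ∈ closure (S : Set L)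
    · exact ⟨0, by simp, fun h => absurd hxS h⟩
    obtain ⟨f, hf, hfx⟩ := exists_addMonoidHom_int_separating S id (-x) fun n hn h => hxS (by
      rw [Set.image_id] at h
      obtain ⟨k, rfl⟩ := Nat.exists_eq_succ_of_ne_zero hn
      -- As `x` lies in the closure, a positive multiple of `-x` there brings in `-x` itself.
      have hk : -x = (k + 1) • -x + k • x := by
        rw [add_smul, one_smul, smul_neg]; abel
      rw [hk]
      exact add_mem h (nsmul_mem (subset_closure hx) k))
    exact ⟨f, hf, fun _ => by simpa using hfx⟩
  choose! f hf hfpos using hsep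
  refine ⟨∑ x ∈ S, f x, fun x hx => ?_⟩
  have hS : ∀ y ∈ S, 0 ≤ (∑ x ∈ S, f x) y ∧ ((∑ x ∈ S, f x) y ≤ 0 → -y ∈ closure (S : Set L)) := by
    intro y hy
    rw [AddMonoidHom.finsetSum_apply]
    refine ⟨Finset.sum_nonneg fun x hx => hf x hx y hy, fun h => ?_⟩
    by_contra hyS
    exact absurd h (not_le.2 (Finset.sum_pos' (fun x hx => hf x hx y hy) ⟨y, hy, hfpos y hy hyS⟩))
  induction hx using closure_induction with
  | mem y hy => exact hS y hy
  | zero => simp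
  | add y z _ _ hy hz =>
    rw [map_add, neg_add]
    exact ⟨add_nonneg hy.1 hz.1, fun h => add_mem (hy.2 (by linarith [hz.1]))
      (hz.2 (by linarith [hy.1]))⟩

/-- The half-space is `ker f + ℕ t`, where `f t` generates the image of `f`; the kernel is finitely
generated by noetherianity. -/
theorem fg_comap_nonneg [Module.Finite ℤ L] (f : L →+ ℤ) :
    ((AddSubmonoid.nonneg ℤ).comap f).FG := by
  have hker : f.ker.toAddSubmonoid.FG := by
    rw [← AddSubgroup.fg_iff_addSubmonoid_fg, ← AddSubgroup.toIntSubmodule_toAddSubgroup f.ker,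
      ← Submodule.fg_iff_addSubgroup_fg]
    exact IsNoetherian.noetherian _
  obtain ⟨d, hd⟩ := Int.subgroup_cyclic f.range
  obtain ⟨t, ht⟩ : ∃ t, f t = |d| := by
    have : |d| ∈ f.range := by
      rw [hd, ← AddSubgroup.zmultiples_eq_closure, Int.mem_zmultiples_iff, dvd_abs]
    exact this
  have heq : (AddSubmonoid.nonneg ℤ).comap f = f.ker.toAddSubmonoid ⊔ multiples t := by
    apply le_antisymm
    · intro x hx
      replace hx : 0 ≤ f x := hx
      have hdvd : |d| ∣ f x := by
        rw [abs_dvd, ← Int.mem_zmultiples_iff, AddSubgroup.zmultiples_eq_closure, ← hd]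
        exact ⟨x, rfl⟩
      obtain ⟨k, hk⟩ : ∃ k : ℕ, f x = |d| * k := by
        obtain ⟨c, hc⟩ := hdvd
        obtain h0 | h0 := (abs_nonneg d).eq_or_lt
        · exact ⟨0, by rw [hc, ← h0]; simp⟩
        · rw [hc] at hx
          obtain ⟨k, rfl⟩ := Int.eq_ofNat_of_zero_le (nonneg_of_mul_nonneg_right hx h0)
          exact ⟨k, hc⟩
      refine mem_sup.2 ⟨x - k • t, ?_, k • t, ⟨k, rfl⟩, by abel⟩
      change x - k • t ∈ f.ker
      rw [AddMonoidHom.mem_ker, map_sub, map_nsmul, ht, hk, nsmul_eq_mul, mul_comm, sub_self]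
    · refine sup_le (fun x hx => ?_) (multiples_le.2 ?_)
      · exact (show f x = 0 from hx).ge
      · change 0 ≤ f t
        rw [ht]
        exact abs_nonneg d
  rw [heq]
  exact hker.sup ⟨{t}, by simp [multiples_eq_closure]⟩

end AddSubmonoid

theorem mainTheorem6 (L : Type*) [AddCommGroup L] :
    (∀ Q : AddSubmonoid L,
      Q.IsDominationMaximal ↔ (IsValuativeAddMonoid Q ∧ Q.GpEqTop)) ∧
    (∀ P : AddSubmonoid L, ∃ Q : AddSubmonoid L,
      P.DominatedBy Q ∧ IsValuativeAddMonoid Q ∧ Q.GpEqTop) ∧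
    (AddGroup.FG L → ∀ P : AddSubmonoid L, P.FG → ∃ Q : AddSubmonoid L,
      P.DominatedBy Q ∧ IsValuativeAddMonoid Q ∧ Q.FG ∧ Q.GpEqTop) := by
  have hmax : ∀ Q : AddSubmonoid L,
      Q.IsDominationMaximal ↔ (IsValuativeAddMonoid Q ∧ Q.GpEqTop) := fun Q =>
    Q.isDominationMaximal_iff.trans Q.isValuative_and_gpEqTop_iff.symm
  refine ⟨hmax, fun P => ?_, fun hL P hP => ?_⟩
  · obtain ⟨Q, hPQ, hQ⟩ := P.exists_dominatedBy_isDominationMaximal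
    exact ⟨Q, hPQ, (hmax Q).1 hQ⟩
  · have : Module.Finite ℤ L := Module.Finite.iff_addGroup_fg.2 hL
    obtain ⟨f, hf⟩ := hP.exists_addMonoidHom_int
    have hQ := ((AddSubmonoid.nonneg ℤ).comap f).isValuative_and_gpEqTop_iff.2 fun x => by
      change 0 ≤ f x ∨ 0 ≤ f (-x)
      rw [map_neg, neg_nonneg]
      exact le_total _ _
    refine ⟨_, AddSubmonoid.dominatedBy_iff.2 ⟨fun x hx => (hf x hx).1, fun x hx hxQ => ?_⟩, hQ.1,
      AddSubmonoid.fg_comap_nonneg f, hQ.2⟩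
    replace hxQ : 0 ≤ f (-x) := hxQ
    rw [map_neg, neg_nonneg] at hxQ
    exact (hf x hx).2 hxQ
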